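/- For a prime $\ell\ge 3$ and a positive integer $k\le \ell-2$, let $$M_{k,\ell}=\{j\in(\mathbb Z/\ell\mathbb Z)^* : \langle kj\rangle_\ell+\langle j\rangle_\ell<\ell\},\qquad W_{k,\ell}=\{w\in(\mathbb Z/\ell\mathbb Z)^* : wM_{k,\ell}=M_{k,\ell}\},$$ where $\langle j\rangle_\ell$ denotes the representative of $j$ modulo $\ell$ in the range $1,\dots,\ell-1$. Put $E_{k,\ell}(a)=0$ if $a\in M_{k,\ell}$ and $E_{k,\ell}(a)=1$ otherwise, and define the Demjanenko matrix $$D_{k,\ell}=\left(E_{k,\ell}(-c^{-1}a)-\tfrac12\right)_{c,a\in M_{k,\ell}/W_{k,\ell}}.$$ Let $\mathcal K_\ell$ be the set of positive integers $k\le \ell-2$ for which $D_{k,\ell}$ is singular. Then there is an absolute constant $C>0$ such that for every real $x\ge 2$ the number of primes $\ell\le x$ with $\ell\equiv 1\pmod 3$ and $\mathcal K_\ell=\emptyset$ is at most $C\,x^{3/4}(\log x)^3$. -/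

import Mathlib

open scoped Pointwise

noncomputable section

namespace Demjanenko

/-- The set `M_{k,ℓ}` of units `j` modulo `ℓ` with `⟨k j⟩ + ⟨j⟩ < ℓ`, where `⟨·⟩` is the least
nonnegative representative modulo `ℓ` (it lies in `1, …, ℓ - 1` for nonzero classes). -/
def M (k ℓ : ℕ) : Set (ZMod ℓ)ˣ :=
  {j | ((k : ZMod ℓ) * (j : ZMod ℓ)).val + (j : ZMod ℓ).val < ℓ}

/-- The subgroup `W_{k,ℓ}` of units `w` with `w M_{k,ℓ} = M_{k,ℓ}`. -/
def W (k ℓ : ℕ) : Subgroup (ZMod ℓ)ˣ :=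
  MulAction.stabilizer (ZMod ℓ)ˣ (M k ℓ)

/-- The function `E_{k,ℓ}`: it is `0` on `M_{k,ℓ}` and `1` off it. -/
def E (k ℓ : ℕ) (a : (ZMod ℓ)ˣ) : ℚ :=
  open Classical in if a ∈ M k ℓ then 0 else 1

theorem mul_mem_M_iff {k ℓ : ℕ} {w : (ZMod ℓ)ˣ} (hw : w ∈ W k ℓ) (a : (ZMod ℓ)ˣ) :
    a * w ∈ M k ℓ ↔ a ∈ M k ℓ := by
  have h : w • M k ℓ = M k ℓ := hw
  have h2 : w • a ∈ w • M k ℓ ↔ a ∈ M k ℓ := Set.smul_mem_smul_set_iff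
  rw [h, smul_eq_mul, mul_comm] at h2
  exact h2

/-- `E_{k,ℓ}` as a function on the quotient group by `W_{k,ℓ}`. -/
def EQuot (k ℓ : ℕ) (q : (ZMod ℓ)ˣ ⧸ W k ℓ) : ℚ :=
  Quotient.liftOn' q (E k ℓ) (by
    intro a b hab
    have hw : a⁻¹ * b ∈ W k ℓ := QuotientGroup.leftRel_apply.mp hab
    have h := mul_mem_M_iff hw a
    rw [mul_inv_cancel_left] at h
    unfold E
    by_cases ha : a ∈ M k ℓ
    · rw [if_pos ha, if_pos (h.mpr ha)]
    · rw [if_neg ha, if_neg (fun hb => ha (h.mp hb))])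

/-- The index set `M_{k,ℓ} / W_{k,ℓ}`, i.e. the set of cosets of `W_{k,ℓ}` contained
in `M_{k,ℓ}`, as a subset of the quotient group. -/
def Idx (k ℓ : ℕ) : Type :=
  ↥((fun j : (ZMod ℓ)ˣ => (j : (ZMod ℓ)ˣ ⧸ W k ℓ)) '' M k ℓ)

instance (ℓ : ℕ) : Finite (ZMod ℓ)ˣ := by
  cases ℓ with
  | zero => exact (inferInstance : Finite ℤˣ)
  | succ n => infer_instance

instance (k ℓ : ℕ) : Finite (Idx k ℓ) :=
  (Set.toFinite ((fun j : (ZMod ℓ)ˣ => (j : (ZMod ℓ)ˣ ⧸ W k ℓ)) '' M k ℓ)).to_subtype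

instance (k ℓ : ℕ) : Fintype (Idx k ℓ) := Fintype.ofFinite _

instance (k ℓ : ℕ) : DecidableEq (Idx k ℓ) := Classical.decEq _

/-- The Demjanenko matrix `D_{k,ℓ} = (E_{k,ℓ}(-c⁻¹ a) - 1/2)`, `c, a ∈ M_{k,ℓ} / W_{k,ℓ}`. -/
def D (k ℓ : ℕ) : Matrix (Idx k ℓ) (Idx k ℓ) ℚ :=
  Matrix.of fun c a =>
    EQuot k ℓ (((-1 : (ZMod ℓ)ˣ) : (ZMod ℓ)ˣ ⧸ W k ℓ) * c.1⁻¹ * a.1) - 1 / 2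

/-- The set `K_ℓ` of positive integers `k ≤ ℓ - 2` for which `D_{k,ℓ}` is singular. -/
def K (ℓ : ℕ) : Set ℕ :=
  {k | 1 ≤ k ∧ k + 2 ≤ ℓ ∧ (D k ℓ).det = 0}

end Demjanenko

end

/-!
Let `χ` be an odd character modulo `ℓ`. As `⟨j⟩ + ⟨k j⟩ + ⟨-(k + 1) j⟩` is `ℓ` on `M` and `2 ℓ` off
it, the sum of `(E j - 1 / 2) χ(j)` over all units is a multiple of `1 + χ(k)⁻¹ - χ(k + 1)⁻¹`
(`Demjanenko.sum_E_mul_eq_zero`). If the stabilizer `W` is trivial and this factor vanishes, then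
`χ` restricted to `M` lies in the kernel of `D`, since `M` is a half-system modulo `±1`
(`Demjanenko.det_D_eq_zero`).

The factor vanishes when `χ(k)⁻¹ = ω` and `χ(k + 1)⁻¹ = 1 + ω = -ω²` for a primitive cube root of
unity `ω`. For `ℓ ≡ 1 (mod 3)` and `2 ^ s` the exact power of `2` in `ℓ - 1`, a character of order
`d = 3 * 2 ^ s` is odd and takes these values at `k`, `k + 1` for at least `(ℓ - 2) / d² - √ℓ`
residues `k`, by the bound `√ℓ` for Jacobi sums (`card_consecutive_values_ge`). So if `2 ^ s` is
below a small constant times `ℓ ^ (1 / 4)`, there are more than `5000` such `k`.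

For at most `5000` residues `k` can `W` be nontrivial. The Fourier transform of `j ↦ ⟨j⟩` is
`ℓ / (e(t / ℓ) - 1)`, so an element of `W` provides an identity between two sums of three such
values. The value at `t = 1` dominates and is isolated, which determines the identity completely
unless a quotient of two of `1, k⁻¹, -(k + 1)⁻¹` is a fraction with small numerator and
denominator, or `k ^ 2 + k + 1 = 0` (`eq_one_of_invCharSubOne_invariant`, `Demjanenko.W_eq_bot`).

Hence `K_ℓ = ∅` forces `ℓ = 2 ^ s * m + 1` with `m` at most a constant times `x ^ (3 / 4)`, and
`s ≤ log₂ x` (`Demjanenko.K_nonempty`, `two_adic_bound`). This gives the bound with a single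
logarithm, and `log x` is at most a constant times `(log x) ^ 3` for `x ≥ 2`.
-/

noncomputable section

/-! ### Jacobi sums and consecutive values of a character -/

section CharacterCount

open Finset

variable {F : Type*} [Field F]

/-- Detection of the value `α` of `χ`, where `χ` and `α` both have order dividing `d`. -/
lemma sum_pow_mulChar_eq {χ : MulChar F ℂ} {d : ℕ} (hd : 0 < d) (hχ : χ ^ d = 1) {α : ℂ}
    (hα : α ^ d = 1) (k : F) :
    ∑ i ∈ range d, α⁻¹ ^ i * (χ ^ i) k = if χ k = α then (d : ℂ) else 0 := by
  have hα0 : α ≠ 0 := by rintro rfl; simp [hd.ne'] at hα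
  rcases eq_or_ne k 0 with rfl | hk
  · simp only [MulChar.map_zero, mul_zero, sum_const_zero, hα0.symm, if_false]
  have hpow : ∀ i, (χ ^ i) k = χ k ^ i := fun i => by
    simpa using MulChar.pow_apply_coe χ i (Units.mk0 k hk)
  have hkd : χ k ^ d = 1 := by
    rw [← hpow, hχ]; exact MulChar.one_apply_coe (Units.mk0 k hk)
  simp_rw [hpow, ← mul_pow]
  split_ifs with h
  · rw [h, inv_mul_cancel₀ hα0]; simp
  · have hz : α⁻¹ * χ k ≠ 1 := fun hz => h (by field_simp at hz; exact hz)
    rw [geom_sum_eq hz, mul_pow, inv_pow, hα, hkd]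
    simp

variable [Fintype F]

lemma norm_mulChar_le_one (χ : MulChar F ℂ) (a : F) : ‖χ a‖ ≤ 1 := by
  rcases eq_or_ne a 0 with rfl | ha
  · simp [χ.map_zero]
  · have h : χ a ^ (Fintype.card F - 1) = 1 := by
      rw [← map_pow, FiniteField.pow_card_sub_one_eq_one a ha, map_one]
    have hc : Fintype.card F - 1 ≠ 0 := by have := Fintype.one_lt_card (α := F); omega
    exact (Complex.norm_eq_one_of_pow_eq_one h hc).le

/-- Jacobi sums of complex characters, not both trivial, are at most `√q` in absolute value. -/
lemma norm_jacobiSum_le {χ φ : MulChar F ℂ} (h : ¬ (χ = 1 ∧ φ = 1)) :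
    ‖jacobiSum χ φ‖ ≤ √(Fintype.card F) := by
  have h1 : (1 : ℝ) ≤ √(Fintype.card F) := by
    rw [Real.one_le_sqrt]; exact_mod_cast Fintype.card_pos
  by_cases hχ : χ = 1
  · subst hχ
    rw [jacobiSum_one_nontrivial (fun h' => h ⟨rfl, h'⟩)]
    simpa using h1
  by_cases hφ : φ = 1
  · subst hφ
    rw [jacobiSum_comm, jacobiSum_one_nontrivial hχ]
    simpa using h1
  by_cases hχφ : χ * φ = 1
  · rw [← inv_eq_of_mul_eq_one_right hχφ, jacobiSum_nontrivial_inv hχ, norm_neg]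
    exact (norm_mulChar_le_one χ _).trans h1
  have hc : ringChar ℂ ≠ ringChar F := by
    rw [ringChar.eq_zero]
    exact (CharP.ringChar_ne_zero_of_finite F).symm
  have key := jacobiSum_mul_jacobiSum_inv hc hχ hφ hχφ
  have hconj : jacobiSum χ⁻¹ φ⁻¹ = star (jacobiSum χ φ) := by
    simp only [jacobiSum, star_sum, star_mul, MulChar.star_apply', mul_comm]
  rw [hconj] at key
  have h2 : ‖jacobiSum χ φ‖ * ‖jacobiSum χ φ‖ = Fintype.card F := by
    have := congrArg norm key
    rwa [norm_mul, norm_star, Complex.norm_natCast] at this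
  exact Real.le_sqrt_of_sq_le (by rw [sq, h2])

/-- The sum over `k` of `χ k * φ (k + 1)` is, up to a factor `χ (-1)`, a Jacobi sum. -/
lemma sum_mul_shift_eq_jacobiSum (χ φ : MulChar F ℂ) :
    ∑ k, χ k * φ (k + 1) = χ (-1) * jacobiSum χ φ := by
  rw [jacobiSum, mul_sum]
  refine Fintype.sum_equiv (Equiv.neg F) _ _ fun k => ?_
  rw [← mul_assoc, ← map_mul, Equiv.neg_apply, neg_one_mul, neg_neg, sub_neg_eq_add, add_comm]

open Classical in
/-- If `χ` has order `d`, every pair `(α, β)` of `d`-th roots of unity is the pair of values of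
`χ` at two consecutive elements of `F`, at least `(q - 2) / d² - √q` times. -/
lemma card_consecutive_values_ge {χ : MulChar F ℂ} {d : ℕ} (hd : 0 < d) (hχ : orderOf χ = d)
    {α β : ℂ} (hα : α ^ d = 1) (hβ : β ^ d = 1) :
    (Fintype.card F - 2 : ℝ) - d ^ 2 * √(Fintype.card F) ≤
      d ^ 2 * #{k : F | χ k = α ∧ χ (k + 1) = β} := by
  have hχd : χ ^ d = 1 := hχ ▸ pow_orderOf_eq_one χ
  set N := #{k : F | χ k = α ∧ χ (k + 1) = β} with hN
  set f : ℕ × ℕ → ℂ := fun ij => α⁻¹ ^ ij.1 * β⁻¹ ^ ij.2 *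
    ((χ ^ ij.1) (-1) * jacobiSum (χ ^ ij.1) (χ ^ ij.2)) with hf
  have hsum : (d : ℂ) ^ 2 * N = ∑ ij ∈ range d ×ˢ range d, f ij := by
    have h1 : (d : ℂ) ^ 2 * N = ∑ k : F, (∑ i ∈ range d, α⁻¹ ^ i * (χ ^ i) k) *
        ∑ j ∈ range d, β⁻¹ ^ j * (χ ^ j) (k + 1) := by
      simp_rw [sum_pow_mulChar_eq hd hχd hα, sum_pow_mulChar_eq hd hχd hβ]
      rw [hN, card_filter]
      push_cast
      rw [mul_sum]
      refine sum_congr rfl fun k _ => ?_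
      by_cases h1 : χ k = α <;> by_cases h2 : χ (k + 1) = β <;> simp [h1, h2, sq]
    rw [h1, sum_product]
    simp_rw [sum_mul_sum]
    rw [sum_comm]
    refine sum_congr rfl fun i _ => ?_
    rw [sum_comm]
    refine sum_congr rfl fun j _ => ?_
    rw [hf]
    simp only
    rw [← sum_mul_shift_eq_jacobiSum, mul_sum]
    refine sum_congr rfl fun k _ => ?_
    ring
  have hmem : ((0, 0) : ℕ × ℕ) ∈ range d ×ˢ range d := by simp [hd]
  have h00 : f (0, 0) = Fintype.card F - 2 := by
    have : (1 : MulChar F ℂ) (-1) = 1 := MulChar.one_apply isUnit_one.neg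
    simp [hf, this, jacobiSum_one_one]
  have hnα : ‖α⁻¹‖ = 1 := by
    rw [norm_inv, Complex.norm_eq_one_of_pow_eq_one hα hd.ne', inv_one]
  have hnβ : ‖β⁻¹‖ = 1 := by
    rw [norm_inv, Complex.norm_eq_one_of_pow_eq_one hβ hd.ne', inv_one]
  have hbound : ∀ ij ∈ (range d ×ˢ range d).erase (0, 0), ‖f ij‖ ≤ √(Fintype.card F) := by
    rintro ⟨i, j⟩ hij
    simp only [mem_erase, mem_product, mem_range, ne_eq, Prod.mk.injEq] at hij
    obtain ⟨hne, hi, hj⟩ := hij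
    have hzero : ∀ n < d, χ ^ n = 1 → n = 0 := fun n hn h => by
      have := orderOf_dvd_of_pow_eq_one h
      exact Nat.eq_zero_of_dvd_of_lt this (hχ ▸ hn)
    have h2 : ‖jacobiSum (χ ^ i) (χ ^ j)‖ ≤ √(Fintype.card F) :=
      norm_jacobiSum_le fun h => hne ⟨hzero i hi h.1, hzero j hj h.2⟩
    simp only [hf, norm_mul, norm_pow, hnα, hnβ, one_pow, one_mul]
    exact (mul_le_of_le_one_left (norm_nonneg _) (norm_mulChar_le_one _ _)).trans h2
  rw [← add_sum_erase _ _ hmem, h00] at hsum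
  have h3 : ‖(d : ℂ) ^ 2 * N - (Fintype.card F - 2)‖ ≤ d ^ 2 * √(Fintype.card F) := by
    rw [hsum, add_sub_cancel_left]
    refine (norm_sum_le_of_le _ hbound).trans ?_
    rw [sum_const, nsmul_eq_mul]
    gcongr
    exact_mod_cast (card_erase_le).trans (by simp [sq])
  have h4 : ((d : ℂ) ^ 2 * N - (Fintype.card F - 2)) =
      (((d : ℝ) ^ 2 * N - (Fintype.card F - 2) : ℝ) : ℂ) := by push_cast; ring
  rw [h4, Complex.norm_real, Real.norm_eq_abs] at h3
  linarith [neg_le_of_abs_le h3]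

end CharacterCount

/-- A character of `(ℤ/p)ˣ` whose order is divisible by the full power of `2` in `p - 1`
is odd. -/
lemma mulChar_neg_one_of_two_pow_dvd {p s m : ℕ} [Fact p.Prime] (hs : s ≠ 0)
    (hp : p = 2 ^ s * m + 1) (hm : Odd m) {χ : MulChar (ZMod p) ℂ} (hχ : 2 ^ s ∣ orderOf χ) :
    χ (-1) = -1 := by
  have hsq : χ (-1) * χ (-1) = 1 := by rw [← map_mul]; simp
  rcases mul_self_eq_one_iff.mp hsq with h | h
  · exfalso
    have h1 : χ ^ (p / 2) = 1 := by
      ext a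
      rw [MulChar.pow_apply_coe, ← map_pow, MulChar.one_apply_coe]
      rcases ZMod.pow_div_two_eq_neg_one_or_one p a.ne_zero with h' | h' <;> simp [h', h]
    have h2 := hχ.trans (orderOf_dvd_of_pow_eq_one h1)
    obtain ⟨t, rfl⟩ := Nat.exists_eq_succ_of_ne_zero hs
    have h3 : p / 2 = 2 ^ t * m := by
      rw [hp, Nat.succ_eq_add_one, pow_succ]
      generalize 2 ^ t = u
      have : u * 2 * m = 2 * (u * m) := by ring
      omega
    rw [h3, Nat.succ_eq_add_one, pow_succ] at h2
    have h4 : 2 ∣ m := Nat.dvd_of_mul_dvd_mul_left (by positivity) h2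
    exact (Nat.not_even_iff_odd.mpr hm) (even_iff_two_dvd.mpr h4)
  · exact h

/-! ### The Fourier transform of the least residue -/

section Cot

variable {p : ℕ} [Fact p.Prime]

/-- The function `t ↦ (e(t / p) - 1)⁻¹` on `ℤ/p`. Up to the factor `p` it is the discrete Fourier
transform of the least nonnegative residue, see `sum_val_mul_stdAddChar`. -/
def invCharSubOne (t : ZMod p) : ℂ := (ZMod.stdAddChar t - 1)⁻¹

lemma stdAddChar_sub_one_ne_zero {t : ZMod p} (ht : t ≠ 0) : ZMod.stdAddChar t - 1 ≠ 0 := by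
  rw [sub_ne_zero, ← AddChar.map_zero_eq_one (ZMod.stdAddChar (N := p))]
  exact fun h => ht (ZMod.injective_stdAddChar h)

lemma norm_stdAddChar (t : ZMod p) : ‖ZMod.stdAddChar t‖ = 1 := by
  rw [ZMod.stdAddChar_apply]; exact Circle.norm_coe _

lemma val_sub_one_eq (j : ZMod p) :
    ((j - 1).val : ℂ) = j.val - 1 + if j = 0 then (p : ℂ) else 0 := by
  have hp : 1 < p := (Fact.out : p.Prime).one_lt
  have : Fact (1 < p) := ⟨hp⟩
  split_ifs with h
  · subst h
    rw [zero_sub, ZMod.neg_val, if_neg one_ne_zero, ZMod.val_one, ZMod.val_zero,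
      Nat.cast_sub hp.le]
    push_cast; ring
  · have h1 : 1 ≤ j.val := Nat.one_le_iff_ne_zero.mpr (by rwa [Ne, ZMod.val_eq_zero])
    rw [ZMod.val_sub (by rwa [ZMod.val_one]), ZMod.val_one, Nat.cast_sub h1]
    push_cast; ring

lemma sum_val_mul_stdAddChar {t : ZMod p} (ht : t ≠ 0) :
    ∑ j : ZMod p, (j.val : ℂ) * ZMod.stdAddChar (t * j) = p * invCharSubOne t := by
  have h0 : ∑ j : ZMod p, (ZMod.stdAddChar (t * j) : ℂ) = 0 := by
    simp_rw [mul_comm t]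
    rw [AddChar.sum_mulShift t (ZMod.isPrimitive_stdAddChar p), if_neg ht, Nat.cast_zero]
  have h1 : (∑ j : ZMod p, (j.val : ℂ) * ZMod.stdAddChar (t * j)) * ZMod.stdAddChar t =
      ∑ j : ZMod p, ((j - 1).val : ℂ) * ZMod.stdAddChar (t * j) := by
    rw [Finset.sum_mul]
    refine Fintype.sum_equiv (Equiv.addRight 1) _ _ fun j => ?_
    rw [Equiv.coe_addRight, add_sub_cancel_right, mul_add, mul_one, AddChar.map_add_eq_mul,
      mul_assoc]
  simp_rw [val_sub_one_eq, add_mul, sub_mul, one_mul, Finset.sum_add_distrib,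
    Finset.sum_sub_distrib, h0, ite_mul, zero_mul] at h1
  rw [Finset.sum_ite_eq' Finset.univ, if_pos (Finset.mem_univ _), mul_zero,
    AddChar.map_zero_eq_one] at h1
  rw [invCharSubOne, eq_mul_inv_iff_mul_eq₀ (stdAddChar_sub_one_ne_zero ht)]
  linear_combination h1

lemma sum_val_mul_left_mul_stdAddChar {t u : ZMod p} (ht : t ≠ 0) (hu : u ≠ 0) :
    ∑ j : ZMod p, ((u * j).val : ℂ) * ZMod.stdAddChar (t * j) = p * invCharSubOne (u⁻¹ * t) := by
  rw [← sum_val_mul_stdAddChar (mul_ne_zero (inv_ne_zero hu) ht)]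
  refine Fintype.sum_equiv (Equiv.mulLeft₀ u hu) _ _ fun j => ?_
  rw [Equiv.mulLeft₀_apply]
  congr 2
  field_simp

lemma norm_stdAddChar_sub_one (t : ZMod p) :
    ‖ZMod.stdAddChar t - 1‖ = 2 * |Real.sin (Real.pi * t.valMinAbs / p)| := by
  conv_lhs => rw [← ZMod.coe_valMinAbs t, ZMod.stdAddChar_coe]
  have : (2 * Real.pi * Complex.I * t.valMinAbs / p : ℂ) =
      Complex.I * ((2 * (Real.pi * t.valMinAbs / p) : ℝ) : ℂ) := by push_cast; ring
  rw [this, Complex.norm_exp_I_mul_ofReal_sub_one, mul_div_cancel_left₀ _ two_ne_zero, norm_mul,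
    Real.norm_ofNat, Real.norm_eq_abs]

lemma le_norm_stdAddChar_sub_one (t : ZMod p) :
    4 * (t.valMinAbs.natAbs : ℝ) / p ≤ ‖ZMod.stdAddChar t - 1‖ := by
  have hp : (0 : ℝ) < p := by exact_mod_cast (Fact.out : p.Prime).pos
  have hv : |(t.valMinAbs : ℝ)| ≤ p / 2 := by
    have h := ZMod.natAbs_valMinAbs_le t
    have h2 : ((t.valMinAbs.natAbs : ℕ) : ℝ) ≤ p / 2 :=
      (Nat.cast_le.mpr h).trans Nat.cast_div_le
    rwa [Nat.cast_natAbs, Int.cast_abs] at h2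
  have habs : |Real.pi * t.valMinAbs / p| = Real.pi * |(t.valMinAbs : ℝ)| / p := by
    rw [abs_div, abs_mul, abs_of_pos Real.pi_pos, abs_of_pos hp]
  have hle : |Real.pi * t.valMinAbs / p| ≤ Real.pi / 2 := by
    rw [habs, div_le_iff₀ hp]
    nlinarith [Real.pi_pos]
  have h := Real.mul_abs_le_abs_sin hle
  rw [norm_stdAddChar_sub_one]
  have h3 : 4 * (t.valMinAbs.natAbs : ℝ) / p = 2 * (2 / Real.pi * |Real.pi * t.valMinAbs / p|) := by
    rw [habs, Nat.cast_natAbs, Int.cast_abs]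
    field_simp
    ring
  rw [h3]
  gcongr

lemma norm_stdAddChar_one_sub_one_le :
    ‖ZMod.stdAddChar (1 : ZMod p) - 1‖ ≤ 2 * Real.pi / p := by
  have h := ZMod.stdAddChar_coe (N := p) 1
  rw [Int.cast_one] at h
  have h2 : (2 * Real.pi * Complex.I * (1 : ℤ) / p : ℂ) =
      Complex.I * ((2 * Real.pi / p : ℝ) : ℂ) := by push_cast; ring
  rw [h, h2]
  refine Real.norm_exp_I_mul_ofReal_sub_one_le.trans (le_of_eq ?_)
  rw [Real.norm_eq_abs, abs_of_nonneg (by positivity)]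

lemma norm_invCharSubOne_le {t : ZMod p} (ht : 20 ≤ t.valMinAbs.natAbs) :
    ‖invCharSubOne t‖ ≤ p / 80 := by
  have hp : (0 : ℝ) < p := by exact_mod_cast (Fact.out : p.Prime).pos
  have h : (80 : ℝ) / p ≤ ‖ZMod.stdAddChar t - 1‖ := by
    refine le_trans ?_ (le_norm_stdAddChar_sub_one t)
    have : (20 : ℝ) ≤ t.valMinAbs.natAbs := by exact_mod_cast ht
    gcongr
    linarith
  rw [invCharSubOne, norm_inv, ← inv_div]
  gcongr

/-- The value of `invCharSubOne` at `1`, of size about `p / (2 π)`, is isolated among its values.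
The chord `Q` from `e(1 / p)` to `e(v / p)` is at least `4 / p`, which bounds the chord `A` from `1`
to `e(1 / p)`, hence also the chord `P` from `1` to `e(v / p)`, by a multiple of `Q`; the difference
of values has absolute value `Q / (A P)`. -/
lemma lt_norm_invCharSubOne_one_sub {v : ZMod p} (hv0 : v ≠ 0) (hv : v ≠ 1) :
    (p : ℝ) / 20 < ‖invCharSubOne (1 : ZMod p) - invCharSubOne v‖ := by
  have hp : (0 : ℝ) < p := by exact_mod_cast (Fact.out : p.Prime).pos
  set A := ‖ZMod.stdAddChar (1 : ZMod p) - 1‖ with hA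
  set P := ‖ZMod.stdAddChar v - 1‖ with hP
  set Q := ‖ZMod.stdAddChar v - ZMod.stdAddChar (1 : ZMod p)‖ with hQ
  have hQ1 : Q = ‖ZMod.stdAddChar (v - 1) - 1‖ := by
    have : ZMod.stdAddChar v - ZMod.stdAddChar (1 : ZMod p) =
        ZMod.stdAddChar (1 : ZMod p) * (ZMod.stdAddChar (v - 1) - 1) := by
      rw [mul_sub, ← AddChar.map_add_eq_mul, add_sub_cancel, mul_one]
    rw [hQ, this, norm_mul, norm_stdAddChar, one_mul]
  have hQ4 : 4 / p ≤ Q := by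
    rw [hQ1]
    refine le_trans ?_ (le_norm_stdAddChar_sub_one _)
    have : (1 : ℝ) ≤ (v - 1).valMinAbs.natAbs := by
      have : (v - 1).valMinAbs.natAbs ≠ 0 := by
        rw [Ne, Int.natAbs_eq_zero, ZMod.valMinAbs_eq_zero]
        exact sub_ne_zero.mpr hv
      exact_mod_cast Nat.one_le_iff_ne_zero.mpr this
    gcongr
    linarith
  have hA0 : 0 < A := norm_pos_iff.mpr (stdAddChar_sub_one_ne_zero (p := p) one_ne_zero)
  have hP0 : 0 < P := norm_pos_iff.mpr (stdAddChar_sub_one_ne_zero hv0)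
  have hA1 : A ≤ 2 * Real.pi / p := norm_stdAddChar_one_sub_one_le
  have hPQ : P ≤ Q + A := by
    have : ZMod.stdAddChar v - 1 = (ZMod.stdAddChar v - ZMod.stdAddChar (1 : ZMod p)) +
      (ZMod.stdAddChar (1 : ZMod p) - 1) := by ring
    rw [hP, this]; exact norm_add_le _ _
  have heq : ‖invCharSubOne (1 : ZMod p) - invCharSubOne v‖ = Q / (A * P) := by
    rw [invCharSubOne, invCharSubOne,
      inv_sub_inv (stdAddChar_sub_one_ne_zero one_ne_zero) (stdAddChar_sub_one_ne_zero hv0),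
      norm_div, norm_mul]
    congr 2
    ring
  rw [heq, div_lt_div_iff₀ (by norm_num) (by positivity)]
  have hpi := Real.pi_lt_d2
  have hpA : p * A ≤ 2 * Real.pi := by rwa [le_div_iff₀ hp, mul_comm] at hA1
  have hpQ : 4 ≤ p * Q := by rwa [div_le_iff₀ hp, mul_comm] at hQ4
  have hQ0 : 0 < Q := by nlinarith
  have hAQ : A ≤ 1.6 * Q := by
    have : p * A ≤ p * (1.6 * Q) := by nlinarith
    exact le_of_mul_le_mul_left this hp
  calc p * (A * P) = (p * A) * P := by ring
    _ ≤ 6.3 * P := by gcongr; linarith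
    _ ≤ 6.3 * (2.6 * Q) := by gcongr; linarith
    _ < Q * 20 := by linarith

/-- In a sum of three values of `invCharSubOne`, a dominant term at `1` can only be matched by a
term at `1`. -/
lemma eq_one_of_sum_invCharSubOne_eq {c d v x y : ZMod p} (hv : v ≠ 0)
    (hc : 20 ≤ c.valMinAbs.natAbs) (hd : 20 ≤ d.valMinAbs.natAbs)
    (hx : 20 ≤ x.valMinAbs.natAbs) (hy : 20 ≤ y.valMinAbs.natAbs)
    (h : invCharSubOne (1 : ZMod p) + invCharSubOne c + invCharSubOne d =
      invCharSubOne v + invCharSubOne x + invCharSubOne y) : v = 1 := by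
  by_contra hv1
  have h1 := lt_norm_invCharSubOne_one_sub hv hv1
  have h2 : invCharSubOne (1 : ZMod p) - invCharSubOne v =
      (invCharSubOne x + invCharSubOne y) - (invCharSubOne c + invCharSubOne d) := by
    linear_combination h
  rw [h2] at h1
  have h3 := norm_sub_le (invCharSubOne x + invCharSubOne y) (invCharSubOne c + invCharSubOne d)
  have h4 := norm_add_le (invCharSubOne x) (invCharSubOne y)
  have h5 := norm_add_le (invCharSubOne c) (invCharSubOne d)
  linarith [norm_invCharSubOne_le hc, norm_invCharSubOne_le hd, norm_invCharSubOne_le hx,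
    norm_invCharSubOne_le hy]

/-- `r` is not a quotient `y / x`, with `x ≠ 0`, of residues that are both less than `20` in
absolute value. -/
def IsFar (r : ZMod p) : Prop :=
  ∀ x : ZMod p, x ≠ 0 → x.valMinAbs.natAbs < 20 → 20 ≤ (r * x).valMinAbs.natAbs

lemma natAbs_valMinAbs_one : (1 : ZMod p).valMinAbs.natAbs ≤ 1 := by
  have h := (Fact.out : p.Prime).two_le
  have h2 : ((1 : ℕ) : ZMod p).valMinAbs = ((1 : ℕ) : ℤ) :=
    ZMod.valMinAbs_natCast_of_le_half (by omega)
  rw [Nat.cast_one] at h2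
  simp [h2]

lemma IsFar.le {r : ZMod p} (h : IsFar r) : 20 ≤ r.valMinAbs.natAbs := by
  simpa using h 1 one_ne_zero (natAbs_valMinAbs_one.trans_lt (by norm_num))

lemma IsFar.ne_one {r : ZMod p} (h : IsFar r) : r ≠ 1 := by
  rintro rfl
  have := h.le
  have := natAbs_valMinAbs_one (p := p)
  omega

lemma IsFar.ne_zero {r : ZMod p} (h : IsFar r) : r ≠ 0 := by
  rintro rfl
  have := h.le
  simp at this

lemma IsFar.inv {r : ZMod p} (h : IsFar r) : IsFar r⁻¹ := by
  intro x hx0 hx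
  by_contra hlt
  have h1 := h _ (mul_ne_zero (inv_ne_zero h.ne_zero) hx0) (not_le.mp hlt)
  rw [mul_inv_cancel_left₀ h.ne_zero] at h1
  omega

/-- Since `a`, `b` and `b / a` are far, at most one of `v`, `a v`, `b v` is small; that one has to
be `1`. -/
lemma eq_one_or_of_sum_invCharSubOne_eq {a b c d v : ZMod p} (hv : v ≠ 0) (ha : IsFar a)
    (hb : IsFar b) (hab : IsFar (b * a⁻¹)) (hc : 20 ≤ c.valMinAbs.natAbs)
    (hd : 20 ≤ d.valMinAbs.natAbs)
    (h : invCharSubOne (1 : ZMod p) + invCharSubOne c + invCharSubOne d =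
      invCharSubOne v + invCharSubOne (a * v) + invCharSubOne (b * v)) :
    v = 1 ∨ a * v = 1 ∨ b * v = 1 := by
  have hav : a * v ≠ 0 := mul_ne_zero ha.ne_zero hv
  have hbv : b * v ≠ 0 := mul_ne_zero hb.ne_zero hv
  have hab' : b * a⁻¹ * (a * v) = b * v := by
    rw [mul_assoc, inv_mul_cancel_left₀ ha.ne_zero]
  by_cases h1 : v.valMinAbs.natAbs < 20
  · exact .inl (eq_one_of_sum_invCharSubOne_eq hv hc hd (ha v hv h1) (hb v hv h1) h)
  by_cases h2 : (a * v).valMinAbs.natAbs < 20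
  · refine .inr (.inl (eq_one_of_sum_invCharSubOne_eq hav hc hd (not_lt.mp h1)
      (hab' ▸ hab _ hav h2) (h.trans ?_)))
    ring
  · refine .inr (.inr (eq_one_of_sum_invCharSubOne_eq hbv hc hd (not_lt.mp h1) (not_lt.mp h2)
      (h.trans ?_)))
    ring

/-- If `a`, `b` and `b / a` are far and `a b ≠ 1`, then the function
`t ↦ ∑_{s ∈ {1, a, b}} invCharSubOne (s t)` is not invariant under any multiplication `t ↦ u t`
with `u ≠ 1`. Comparing the terms that dominate at `t = 1`, `a⁻¹`, `b⁻¹` shows that such a `u` would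
permute `{1, a, b}`, which forces `a b = 1`. -/
lemma eq_one_of_invCharSubOne_invariant {a b u : ZMod p} (hu : u ≠ 0) (ha : IsFar a)
    (hb : IsFar b) (hab : IsFar (b * a⁻¹)) (hne : a * b ≠ 1)
    (h : ∀ t : ZMod p, t ≠ 0 → invCharSubOne t + invCharSubOne (a * t) + invCharSubOne (b * t) =
      invCharSubOne (u * t) + invCharSubOne (a * (u * t)) + invCharSubOne (b * (u * t))) :
    u = 1 := by
  have ha0 := ha.ne_zero
  have hb0 := hb.ne_zero
  have h1 := eq_one_or_of_sum_invCharSubOne_eq (c := a) (d := b) hu ha hb hab ha.le hb.le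
    (by simpa using h 1 one_ne_zero)
  have h2 := eq_one_or_of_sum_invCharSubOne_eq (c := a⁻¹) (d := b * a⁻¹) (v := u * a⁻¹)
    (mul_ne_zero hu (inv_ne_zero ha0)) ha hb hab ha.inv.le hab.le (by
      rw [← h a⁻¹ (inv_ne_zero ha0), mul_inv_cancel₀ ha0]; ring)
  have hba : IsFar (a * b⁻¹) := by simpa using hab.inv
  have h3 := eq_one_or_of_sum_invCharSubOne_eq (c := b⁻¹) (d := a * b⁻¹) (v := u * b⁻¹)
    (mul_ne_zero hu (inv_ne_zero hb0)) ha hb hab hb.inv.le hba.le (by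
      rw [← h b⁻¹ (inv_ne_zero hb0), mul_inv_cancel₀ hb0]; ring)
  rcases h1 with h1 | h1 | h1
  · exact h1
  · exfalso
    have hu' : u = a⁻¹ := eq_inv_of_mul_eq_one_right h1
    subst hu'
    rcases h3 with h3 | h3 | h3
    · rw [← mul_inv, inv_eq_one] at h3; exact hne h3
    · rw [mul_inv_cancel_left₀ ha0, inv_eq_one] at h3; exact hb.ne_one h3
    · rw [mul_left_comm, mul_inv_cancel₀ hb0, mul_one, inv_eq_one] at h3; exact ha.ne_one h3
  · exfalso
    have hu' : u = b⁻¹ := eq_inv_of_mul_eq_one_right h1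
    subst hu'
    rcases h2 with h2 | h2 | h2
    · rw [← mul_inv, inv_eq_one, mul_comm] at h2; exact hne h2
    · rw [mul_left_comm, mul_inv_cancel₀ ha0, mul_one, inv_eq_one] at h2; exact hb.ne_one h2
    · rw [mul_inv_cancel_left₀ hb0, inv_eq_one] at h2; exact ha.ne_one h2

end Cot

/-! ### The stabilizer `W` and singularity of the Demjanenko matrix -/

namespace Demjanenko

variable {k p : ℕ} [Fact p.Prime]

/-- The three residues of `j`, `k j`, `-(k + 1) j` sum to `p` or `2 p`, and `M` is the set where
the sum is `p`. -/
lemma val_add_val_add_val_eq (hk1 : (k : ZMod p) + 1 ≠ 0) (j : (ZMod p)ˣ) :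
    (((j : ZMod p).val + ((k : ZMod p) * (j : ZMod p)).val +
      (-((k : ZMod p) + 1) * (j : ZMod p)).val : ℕ) : ℚ) =
      p + p * E k p j := by
  have hx : (k : ZMod p) * (j : ZMod p) + (j : ZMod p) ≠ 0 := by
    rw [← add_one_mul]; exact mul_ne_zero hk1 j.ne_zero
  have hneg : -((k : ZMod p) + 1) * (j : ZMod p) = -((k : ZMod p) * (j : ZMod p) + (j : ZMod p)) := by
    ring
  have hlt := ZMod.val_lt ((k : ZMod p) * (j : ZMod p) + (j : ZMod p))
  rw [hneg, ZMod.neg_val, if_neg hx, E, M, Set.mem_ofPred_eq]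
  rw [ZMod.val_add] at hlt ⊢
  have h1 := ZMod.val_lt (j : ZMod p)
  have h2 := ZMod.val_lt ((k : ZMod p) * (j : ZMod p))
  split_ifs with h
  · rw [Nat.mod_eq_of_lt h, mul_zero, add_zero]
    congr 1
    omega
  · rw [Nat.mod_eq_sub_mod (not_lt.mp h), Nat.mod_eq_of_lt (by omega), mul_one]
    norm_cast
    omega

lemma E_neg (hk : (k : ZMod p) ≠ 0) (hk1 : (k : ZMod p) + 1 ≠ 0) (j : (ZMod p)ˣ) :
    E k p (-j) = 1 - E k p j := by
  have h1 := val_add_val_add_val_eq hk1 j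
  have h2 := val_add_val_add_val_eq hk1 (-j)
  have hp : (p : ℚ) ≠ 0 := by exact_mod_cast (Fact.out : p.Prime).ne_zero
  have hv : ∀ u : ZMod p, u ≠ 0 → ((-u).val : ℚ) = p - u.val := fun u hu => by
    rw [ZMod.neg_val, if_neg hu, Nat.cast_sub (ZMod.val_lt u).le]
  rw [Units.val_neg, mul_neg, mul_neg] at h2
  push_cast at h1 h2
  rw [hv _ j.ne_zero, hv _ (mul_ne_zero hk j.ne_zero),
    hv _ (mul_ne_zero (neg_ne_zero.mpr hk1) j.ne_zero)] at h2
  have : (p : ℚ) * E k p (-j) = p * (1 - E k p j) := by linarith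
  exact mul_left_cancel₀ hp this

lemma neg_mem_M_iff (hk : (k : ZMod p) ≠ 0) (hk1 : (k : ZMod p) + 1 ≠ 0) (j : (ZMod p)ˣ) :
    -j ∈ M k p ↔ j ∉ M k p := by
  have h := E_neg hk hk1 j
  unfold E at h
  by_cases h1 : j ∈ M k p <;> by_cases h2 : -j ∈ M k p <;> simp [h1, h2] at h ⊢

/-- The stabilizer of `M` is trivial for all `k` outside a set of bounded size, which
`exceptionalResidues` contains. An element `w` of it leaves the sum of the residues of `j`, `k j`,
`-(k + 1) j` unchanged under `j ↦ w j`; the Fourier transform of this sum is a sum of three values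
of `invCharSubOne`. If `k ^ 2 + k + 1 = 0`, then `k` itself stabilizes `M`. -/
lemma W_eq_bot (hk : (k : ZMod p) ≠ 0) (hk1 : (k : ZMod p) + 1 ≠ 0)
    (ha : IsFar (k : ZMod p)⁻¹) (hb : IsFar (-((k : ZMod p) + 1))⁻¹)
    (hab : IsFar ((-((k : ZMod p) + 1))⁻¹ * (k : ZMod p))) (hne : (k : ZMod p) ^ 2 + k + 1 ≠ 0) :
    W k p = ⊥ := by
  rw [eq_bot_iff]
  intro w hw
  rw [Subgroup.mem_bot]
  have hp : (p : ℂ) ≠ 0 := by exact_mod_cast (Fact.out : p.Prime).ne_zero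
  have hk1' : -((k : ZMod p) + 1) ≠ 0 := neg_ne_zero.mpr hk1
  have hval : ∀ j : ZMod p,
      (((w : ZMod p) * j).val + ((k : ZMod p) * (w : ZMod p) * j).val +
        (-((k : ZMod p) + 1) * (w : ZMod p) * j).val : ℂ) =
      j.val + ((k : ZMod p) * j).val + (-((k : ZMod p) + 1) * j).val := by
    intro j
    rcases eq_or_ne j 0 with rfl | hj
    · simp
    have h1 := val_add_val_add_val_eq hk1 (Units.mk0 j hj)
    have h2 := val_add_val_add_val_eq hk1 (Units.mk0 j hj * w)
    have hE : E k p (Units.mk0 j hj * w) = E k p (Units.mk0 j hj) := by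
      have h := mul_mem_M_iff hw (Units.mk0 j hj)
      unfold E
      by_cases hM : Units.mk0 j hj ∈ M k p
      · rw [if_pos hM, if_pos (h.mpr hM)]
      · rw [if_neg hM, if_neg (mt h.mp hM)]
    rw [hE, ← h1, Nat.cast_inj] at h2
    simp only [Units.val_mul, Units.val_mk0] at h2
    rw [mul_assoc, mul_assoc, mul_comm (w : ZMod p) j]
    exact_mod_cast h2
  have hinv : (w : ZMod p)⁻¹ = 1 := by
    refine eq_one_of_invCharSubOne_invariant (inv_ne_zero w.ne_zero) ha hb
      (by rwa [inv_inv]) ?_ ?_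
    · rw [← mul_inv, Ne, inv_eq_one]
      intro h
      apply hne
      linear_combination -h
    · intro t ht
      refine mul_left_cancel₀ hp ?_
      have h0 := sum_val_mul_stdAddChar ht
      have h1 := sum_val_mul_left_mul_stdAddChar ht hk
      have h2 := sum_val_mul_left_mul_stdAddChar ht hk1'
      have h3 := sum_val_mul_left_mul_stdAddChar ht w.ne_zero
      have h4 := sum_val_mul_left_mul_stdAddChar ht (mul_ne_zero hk w.ne_zero)
      have h5 := sum_val_mul_left_mul_stdAddChar ht (mul_ne_zero hk1' w.ne_zero)
      rw [mul_inv, mul_assoc] at h4 h5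
      rw [mul_add, mul_add, mul_add, mul_add, ← h0, ← h1, ← h2, ← h3, ← h4, ← h5]
      simp_rw [← Finset.sum_add_distrib, ← add_mul, hval]
  rw [inv_eq_one] at hinv
  exact Units.ext hinv

/-- The sum factors as `1 + χ(k)⁻¹ - χ(k + 1)⁻¹` times the sum of `⟨j⟩ χ(j)`, divided by `p`. -/
lemma sum_E_mul_eq_zero (hk : (k : ZMod p) ≠ 0) (hk1 : (k : ZMod p) + 1 ≠ 0)
    {χ : MulChar (ZMod p) ℂ} (hodd : χ (-1) = -1)
    (hχ : 1 + (χ k)⁻¹ = (χ (k + 1))⁻¹) :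
    ∑ j : (ZMod p)ˣ, ((E k p j : ℂ) - 1 / 2) * χ j = 0 := by
  have hp : (p : ℂ) ≠ 0 := by exact_mod_cast (Fact.out : p.Prime).ne_zero
  have hsum : ∑ j : (ZMod p)ˣ, χ j = 0 := by
    have h : ∑ j : (ZMod p)ˣ, χ j = ∑ j : (ZMod p)ˣ, -χ j := by
      refine Fintype.sum_equiv (Equiv.neg _) _ _ fun j => ?_
      rw [Equiv.neg_apply, Units.val_neg, ← neg_one_mul (j : ZMod p), map_mul, hodd]
      ring
    rw [Finset.sum_neg_distrib] at h
    linear_combination h / 2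
  have hmul : ∀ u : ZMod p, u ≠ 0 → ∑ j : (ZMod p)ˣ, ((u * j).val : ℂ) * χ j =
      (χ u)⁻¹ * ∑ j : (ZMod p)ˣ, ((j : ZMod p).val : ℂ) * χ j := by
    intro u hu
    have hχu : χ u ≠ 0 := (IsUnit.map χ (isUnit_iff_ne_zero.mpr hu)).ne_zero
    rw [Finset.mul_sum]
    refine Fintype.sum_equiv (Equiv.mulLeft (Units.mk0 u hu)) _ _ fun j => ?_
    rw [Equiv.coe_mulLeft, Units.val_mul, Units.val_mk0, map_mul]
    field_simp
  have hval : ∀ j : (ZMod p)ˣ, (p : ℂ) * (((E k p j : ℂ) - 1 / 2) * χ j) =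
      ((j : ZMod p).val : ℂ) * χ j + (((k : ZMod p) * (j : ZMod p)).val : ℂ) * χ j +
        ((-((k : ZMod p) + 1) * (j : ZMod p)).val : ℂ) * χ j - 3 / 2 * p * χ j := by
    intro j
    have h := congrArg (Rat.cast (K := ℂ)) (val_add_val_add_val_eq hk1 j)
    push_cast at h
    linear_combination -χ j * h
  refine mul_left_cancel₀ hp ?_
  rw [Finset.mul_sum]
  simp_rw [hval]
  rw [Finset.sum_sub_distrib, Finset.sum_add_distrib, Finset.sum_add_distrib, ← Finset.mul_sum,
    hsum, hmul _ hk, hmul _ (neg_ne_zero.mpr hk1), ← neg_one_mul ((k : ZMod p) + 1), map_mul, hodd,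
    mul_inv, ← hχ]
  ring

/-- An odd character with `1 + χ(k)⁻¹ = χ(k + 1)⁻¹` restricts to a vector in the kernel of the
Demjanenko matrix. -/
lemma det_D_eq_zero (hk : (k : ZMod p) ≠ 0) (hk1 : (k : ZMod p) + 1 ≠ 0) (hW : W k p = ⊥)
    {χ : MulChar (ZMod p) ℂ} (hodd : χ (-1) = -1) (hχ : 1 + (χ k)⁻¹ = (χ (k + 1))⁻¹) :
    (D k p).det = 0 := by
  classical
  have hinj : ∀ a b : (ZMod p)ˣ, (a : (ZMod p)ˣ ⧸ W k p) = b → a = b := fun a b h => by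
    rw [QuotientGroup.eq, hW, Subgroup.mem_bot, inv_mul_eq_one] at h
    exact h
  have hout : ∀ a : (ZMod p)ˣ, ((a : (ZMod p)ˣ ⧸ W k p)).out = a := fun a =>
    hinj _ _ (QuotientGroup.out_eq' _)
  suffices h : ((algebraMap ℚ ℂ).mapMatrix (D k p)).det = 0 by
    rw [← RingHom.map_det] at h
    exact (map_eq_zero _).mp h
  rw [← Matrix.exists_mulVec_eq_zero_iff]
  refine ⟨fun q => χ (q.1.out : (ZMod p)ˣ), ?_, ?_⟩
  · intro h0
    have hne : (M k p).Nonempty := by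
      by_cases h1 : (1 : (ZMod p)ˣ) ∈ M k p
      · exact ⟨1, h1⟩
      · exact ⟨-1, (neg_mem_M_iff hk hk1 1).mpr h1⟩
    obtain ⟨j, hj⟩ := hne
    have h := congrFun h0 ⟨_, j, hj, rfl⟩
    exact (IsUnit.map χ (Units.isUnit _)).ne_zero h
  · funext c
    obtain ⟨q, c, hc, hcq⟩ := c
    subst hcq
    set T : (ZMod p)ˣ → ℂ := fun a => ((E k p (-1 * c⁻¹ * a) : ℂ) - 1 / 2) * χ a with hT
    have hsumM : (((algebraMap ℚ ℂ).mapMatrix (D k p)).mulVec fun q : Idx k p =>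
        χ (q.1.out : (ZMod p)ˣ)) ⟨(c : (ZMod p)ˣ ⧸ W k p), c, hc, rfl⟩ =
        ∑ a with a ∈ M k p, T a := by
      refine Finset.sum_bij (fun q _ => q.1.out) ?_ ?_ ?_ ?_
      · rintro ⟨_, a, ha, rfl⟩ -
        simpa [hout] using ha
      · rintro ⟨_, a, ha, rfl⟩ - ⟨_, b, hb, rfl⟩ - hab
        simp only [hout] at hab
        subst hab
        rfl
      · intro a ha
        exact ⟨⟨_, a, (Finset.mem_filter.mp ha).2, rfl⟩, Finset.mem_univ _, hout a⟩
      · rintro ⟨_, a, ha, rfl⟩ -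
        change algebraMap ℚ ℂ (E k p (-1 * c⁻¹ * a) - 1 / 2) *
          χ ((a : (ZMod p)ˣ ⧸ W k p).out : (ZMod p)ˣ) = T (a : (ZMod p)ˣ ⧸ W k p).out
        simp only [hout, hT]
        simp
    refine hsumM.trans (?_ : _ = (0 : ℂ))
    -- `T` is even and `M` is a half-system, so the sum over `M` is half the sum over the group.
    have hTneg : ∀ a, T (-a) = T a := fun a => by
      have h1 : -1 * c⁻¹ * -a = -(-1 * c⁻¹ * a) := by rw [mul_neg]
      simp only [hT]
      rw [h1, E_neg hk hk1, Units.val_neg, ← neg_one_mul (a : ZMod p), map_mul, hodd]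
      push_cast
      ring
    have hcompl : ∑ a with a ∉ M k p, T a = ∑ a with a ∈ M k p, T a := by
      refine Finset.sum_nbij' (fun a => -a) (fun a => -a) ?_ ?_ ?_ ?_ ?_
      · intro a ha
        simpa [neg_mem_M_iff hk hk1] using ha
      · intro a ha
        simpa [neg_mem_M_iff hk hk1] using ha
      · intro a _; exact neg_neg a
      · intro a _; exact neg_neg a
      · intro a _; exact (hTneg a).symm
    have htot : ∑ a, T a = 0 := by
      have h : ∑ a, T a = χ ((-c : (ZMod p)ˣ) : ZMod p) *
          ∑ j : (ZMod p)ˣ, ((E k p j : ℂ) - 1 / 2) * χ j := by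
        rw [Finset.mul_sum]
        refine Fintype.sum_equiv (Equiv.mulLeft (-1 * c⁻¹)) _ _ fun a => ?_
        have ha : (a : ZMod p) =
            ((-c : (ZMod p)ˣ) : ZMod p) * ((-1 * c⁻¹ * a : (ZMod p)ˣ) : ZMod p) := by
          rw [← Units.val_mul]
          congr 1
          simp
        simp only [hT, Equiv.coe_mulLeft]
        conv_lhs => rw [ha, map_mul]
        ring
      rw [h, sum_E_mul_eq_zero hk hk1 hodd hχ, mul_zero]
    have hsplit := Finset.sum_filter_add_sum_filter_not Finset.univ (· ∈ M k p) T
    rw [hcompl, htot] at hsplit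
    linear_combination hsplit / 2

end Demjanenko

/-! ### Few residues are exceptional -/

section Exceptional

open Finset

variable {p : ℕ}

/-- The residues of absolute value less than `20`. -/
def smallResidues (p : ℕ) : Finset (ZMod p) :=
  (Icc (-19 : ℤ) 19).image (Int.cast : ℤ → ZMod p)

lemma mem_smallResidues {x : ZMod p} (hx : x.valMinAbs.natAbs < 20) : x ∈ smallResidues p :=
  mem_image.mpr ⟨x.valMinAbs, mem_Icc.mpr (by omega), ZMod.coe_valMinAbs x⟩

lemma card_smallResidues_le : #(smallResidues p) ≤ 39 :=
  card_image_le.trans (by simp)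

variable [Fact p.Prime]

/-- All exceptions to the hypotheses of `Demjanenko.W_eq_bot` among the residues `k ≠ 0, -1`. -/
def exceptionalResidues (p : ℕ) [Fact p.Prime] : Finset (ZMod p) :=
  ((smallResidues p ×ˢ smallResidues p).image fun xy => xy.1 / xy.2) ∪
  ((smallResidues p ×ˢ smallResidues p).image fun xy => -xy.1 / xy.2 - 1) ∪
  ((smallResidues p ×ˢ smallResidues p).image fun xy => -xy.2 / (xy.1 + xy.2)) ∪
  univ.filter fun k : ZMod p => k ^ 2 + k + 1 = 0

lemma card_exceptionalResidues_le : #(exceptionalResidues p) ≤ 5000 := by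
  have hprod : #(smallResidues p ×ˢ smallResidues p) ≤ 39 * 39 := by
    rw [card_product]
    exact Nat.mul_le_mul card_smallResidues_le card_smallResidues_le
  have hquad : #(univ.filter fun k : ZMod p => k ^ 2 + k + 1 = 0) ≤ 2 := by
    by_cases h : ∃ r : ZMod p, r ^ 2 + r + 1 = 0
    · obtain ⟨r, hr⟩ := h
      refine (card_le_card (t := {r, -1 - r}) fun k hk => ?_).trans card_le_two
      have hk' := (mem_filter.mp hk).2
      have h0 : (k - r) * (k - (-1 - r)) = 0 := by linear_combination hk' - hr
      rw [mem_insert, mem_singleton]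
      rcases mul_eq_zero.mp h0 with h | h
      · exact .inl (sub_eq_zero.mp h)
      · exact .inr (sub_eq_zero.mp h)
    · rw [filter_eq_empty_iff.mpr fun k _ hk => h ⟨k, hk⟩]
      simp
  refine (card_union_le _ _).trans ?_
  refine (Nat.add_le_add ((card_union_le _ _).trans (Nat.add_le_add (card_union_le _ _) le_rfl))
    hquad).trans ?_
  have h1 := fun f : ZMod p × ZMod p → ZMod p =>
    (card_image_le (s := smallResidues p ×ˢ smallResidues p) (f := f)).trans hprod
  exact (Nat.add_le_add (Nat.add_le_add (Nat.add_le_add (h1 _) (h1 _)) (h1 _)) le_rfl).trans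
    (by norm_num)

lemma exists_small_of_not_isFar {r : ZMod p} (h : ¬ IsFar r) :
    ∃ x ∈ smallResidues p, ∃ y ∈ smallResidues p, x ≠ 0 ∧ r * x = y := by
  simp only [IsFar, not_forall, not_le] at h
  obtain ⟨x, hx0, hx, hy⟩ := h
  exact ⟨x, mem_smallResidues hx, _, mem_smallResidues hy, hx0, rfl⟩

lemma isFar_of_notMem_exceptionalResidues {k : ZMod p} (hk : k ≠ 0) (hk1 : k + 1 ≠ 0)
    (h : k ∉ exceptionalResidues p) :
    IsFar k⁻¹ ∧ IsFar (-(k + 1))⁻¹ ∧ IsFar ((-(k + 1))⁻¹ * k) ∧ k ^ 2 + k + 1 ≠ 0 := by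
  have hk1' : -(k + 1) ≠ 0 := neg_ne_zero.mpr hk1
  simp only [exceptionalResidues, mem_union, mem_image, mem_product, mem_filter, mem_univ,
    true_and, not_or, Prod.exists, not_exists, not_and] at h
  obtain ⟨⟨⟨h1, h2⟩, h3⟩, h4⟩ := h
  refine ⟨?_, ?_, ?_, h4⟩
  · by_contra hf
    obtain ⟨x, hx, y, hy, hx0, hxy⟩ := exists_small_of_not_isFar hf
    have hy0 : y ≠ 0 := hxy ▸ mul_ne_zero (inv_ne_zero hk) hx0
    refine h1 x y ⟨hx, hy⟩ ?_
    rw [div_eq_iff hy0, ← hxy, mul_inv_cancel_left₀ hk]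
  · by_contra hf
    obtain ⟨x, hx, y, hy, hx0, hxy⟩ := exists_small_of_not_isFar hf
    have hy0 : y ≠ 0 := hxy ▸ mul_ne_zero (inv_ne_zero hk1') hx0
    refine h2 x y ⟨hx, hy⟩ ?_
    rw [inv_mul_eq_iff_eq_mul₀ hk1'] at hxy
    rw [sub_eq_iff_eq_add, div_eq_iff hy0]
    linear_combination -hxy
  · by_contra hf
    obtain ⟨x, hx, y, hy, hx0, hxy⟩ := exists_small_of_not_isFar hf
    rw [mul_assoc, inv_mul_eq_iff_eq_mul₀ hk1'] at hxy
    have hxy0 : x + y ≠ 0 := by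
      intro h0
      have hy : y = 0 := by linear_combination hxy - k * h0
      rw [hy, add_zero] at h0
      exact hx0 h0
    refine h3 x y ⟨hx, hy⟩ ?_
    rw [div_eq_iff hxy0]
    linear_combination -hxy

end Exceptional

/-! ### Existence of singular Demjanenko matrices -/

/-- A cube root of unity `ω` other than `1` has `1 + ω = -ω²`, a sixth root of unity: the identity
`1 + ω = -ω²` between roots of unity is what makes the matrices singular. -/
lemma exists_cube_root_one_add_pow_six : ∃ ω : ℂ, ω ^ 3 = 1 ∧ (1 + ω) ^ 6 = 1 := by
  have h := Complex.isPrimitiveRoot_exp 3 (by norm_num)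
  refine ⟨_, h.pow_eq_one, ?_⟩
  have h1 := h.ne_one (by norm_num)
  have h3 := h.pow_eq_one
  generalize Complex.exp _ = ω at h1 h3
  have h2 : ω ^ 2 + ω + 1 = 0 := by
    have : (ω - 1) * (ω ^ 2 + ω + 1) = 0 := by linear_combination h3
    exact (mul_eq_zero.mp this).resolve_left (sub_ne_zero.mpr h1)
  have h4 : 1 + ω = -ω ^ 2 := by linear_combination h2
  rw [h4, neg_pow, ← pow_mul, show 2 * 6 = 3 * 4 by norm_num, pow_mul, h3]
  norm_num

/-- If the power of `2` in `p - 1` is less than a constant times `p ^ (1 / 4)`, then some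
Demjanenko matrix modulo `p` is singular. -/
theorem Demjanenko.K_nonempty {p s m : ℕ} [Fact p.Prime] (hs : s ≠ 0) (hp : p = 2 ^ s * m + 1)
    (hm : Odd m) (h3 : p ≡ 1 [MOD 3]) (hlarge : 10 ^ 8 * (2 ^ s) ^ 4 ≤ p) :
    (Demjanenko.K p).Nonempty := by
  classical
  -- An odd character needs the full power of `2` in its order, a cube root of unity as a value
  -- needs the factor `3`; the count below is useful only while `d` is small against `p ^ (1 / 4)`.
  set d := 2 ^ s * 3 with hd
  have hd0 : 0 < d := by positivity
  have hdvd : d ∣ Fintype.card (ZMod p) - 1 := by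
    rw [ZMod.card]
    refine Nat.Coprime.mul_dvd_of_dvd_of_dvd (Nat.Coprime.pow_left _ (by norm_num)) ?_
      ((Nat.modEq_iff_dvd' (Fact.out : p.Prime).one_lt.le).mp h3.symm)
    rw [hp, Nat.add_sub_cancel]
    exact dvd_mul_right _ _
  obtain ⟨χ, hχ⟩ := MulChar.exists_mulChar_orderOf (ZMod p) hdvd
    (Complex.isPrimitiveRoot_exp d hd0.ne')
  have hodd : χ (-1) = -1 := mulChar_neg_one_of_two_pow_dvd hs hp hm (hχ ▸ dvd_mul_right _ _)
  obtain ⟨ω, hω3, hω6⟩ := exists_cube_root_one_add_pow_six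
  obtain ⟨t, rfl⟩ := Nat.exists_eq_succ_of_ne_zero hs
  have hα : (ω⁻¹) ^ d = 1 := by
    rw [hd, mul_comm, pow_mul, inv_pow, hω3, inv_one, one_pow]
  have hβ : ((1 + ω)⁻¹) ^ d = 1 := by
    rw [hd, Nat.succ_eq_add_one, show 2 ^ (t + 1) * 3 = 6 * 2 ^ t by ring, pow_mul, inv_pow, hω6,
      inv_one, one_pow]
  have hcount := card_consecutive_values_ge hd0 hχ hα hβ
  rw [ZMod.card] at hcount
  set S := Finset.univ.filter fun k : ZMod p => χ k = ω⁻¹ ∧ χ (k + 1) = (1 + ω)⁻¹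
  have hS : 5000 < S.card := by
    set r := √(p : ℝ) with hr
    have hr2 : r ^ 2 = p := Real.sq_sqrt (Nat.cast_nonneg p)
    set q : ℝ := (2 ^ (t + 1)) ^ 2 with hq
    have hq1 : 1 ≤ q := one_le_pow₀ (one_le_pow₀ (by norm_num))
    have hlarge' : (10 : ℝ) ^ 8 * q ^ 2 ≤ r ^ 2 := by
      rw [hr2, hq, ← pow_mul]
      exact_mod_cast hlarge
    have hrq : 10 ^ 4 * q ≤ r := by
      refine le_of_sq_le_sq ?_ (Real.sqrt_nonneg _)
      rw [mul_pow]
      norm_num at hlarge' ⊢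
      exact hlarge'
    have hd2 : (d : ℝ) ^ 2 = 9 * q := by
      rw [hd, hq, Nat.succ_eq_add_one]; push_cast; ring
    rw [hd2, ← hr2] at hcount
    by_contra hle
    have hle' : (S.card : ℝ) ≤ 5000 := by exact_mod_cast not_lt.mp hle
    have h5 : 9 * q * S.card ≤ 9 * q * 5000 := by gcongr
    have h6 : 10 ^ 4 * q * r ≤ r * r := by gcongr
    have h7 : 10 ^ 4 * q * q ≤ r * q := by gcongr
    nlinarith
  obtain ⟨k, hkS, hkE⟩ := Finset.exists_mem_notMem_of_card_lt_card
    (card_exceptionalResidues_le.trans_lt hS)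
  obtain ⟨hk, hk1⟩ := (Finset.mem_filter.mp hkS).2
  have hω0 : ω ≠ 0 := by rintro rfl; simp at hω3
  have hω1 : 1 + ω ≠ 0 := by intro h; simp [h] at hω6
  have hk0 : k ≠ 0 := by
    rintro rfl
    rw [MulChar.map_zero] at hk
    exact inv_ne_zero hω0 hk.symm
  have hk10 : k + 1 ≠ 0 := by
    intro h
    rw [h, MulChar.map_zero] at hk1
    exact inv_ne_zero hω1 hk1.symm
  obtain ⟨ha, hb, hab, hne⟩ := isFar_of_notMem_exceptionalResidues hk0 hk10 hkE
  have hcast : ((k.val : ℕ) : ZMod p) = k := ZMod.natCast_zmod_val k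
  refine ⟨k.val, ?_, ?_, ?_⟩
  · exact Nat.one_le_iff_ne_zero.mpr (by rwa [Ne, ZMod.val_eq_zero])
  · have hlt := ZMod.val_lt k
    by_contra hle
    have : k.val + 1 = p := by omega
    apply hk10
    rw [← hcast]
    have h := congrArg (Nat.cast (R := ZMod p)) this
    simpa using h
  · rw [← hcast] at hk0 hk10 ha hb hab hne hk hk1
    refine Demjanenko.det_D_eq_zero hk0 hk10 (Demjanenko.W_eq_bot hk0 hk10 ha hb hab hne) hodd ?_
    rw [hk, hk1, inv_inv, inv_inv]

/-! ### Counting the exceptional primes -/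

/-- If the power of `2` in `n - 1` exceeds a constant times `n ^ (1 / 4)`, then the cofactor `m` of
that power is at most a constant times `x ^ (3 / 4)`, for every `x ≥ n`. -/
lemma two_adic_bound {s m : ℕ} {x : ℝ} (hx : ((2 ^ s * m + 1 : ℕ) : ℝ) ≤ x)
    (h : 2 ^ s * m + 1 < 10 ^ 8 * (2 ^ s) ^ 4) : (m : ℝ) ≤ 100 * x ^ (3 / 4 : ℝ) := by
  have hu : (0 : ℝ) < 2 ^ s := by positivity
  set u : ℝ := 2 ^ s with hu'
  have hx0 : 0 ≤ x := (Nat.cast_nonneg _).trans hx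
  have h1 : u * m ≤ x := by
    push_cast at hx
    linarith
  have h2 : (m : ℝ) ≤ 10 ^ 8 * u ^ 3 := by
    have h' : ((2 ^ s * m + 1 : ℕ) : ℝ) < ((10 ^ 8 * (2 ^ s) ^ 4 : ℕ) : ℝ) := by exact_mod_cast h
    push_cast at h'
    rw [← hu'] at h'
    have : u * m ≤ u * (10 ^ 8 * u ^ 3) := by nlinarith
    exact le_of_mul_le_mul_left this hu
  have h3 : (m : ℝ) ^ 4 ≤ 10 ^ 8 * x ^ 3 := by
    calc (m : ℝ) ^ 4 = m * m ^ 3 := by ring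
      _ ≤ (10 ^ 8 * u ^ 3) * m ^ 3 := by gcongr
      _ = 10 ^ 8 * (u * m) ^ 3 := by ring
      _ ≤ 10 ^ 8 * x ^ 3 := by gcongr
  have h4 : (100 * x ^ (3 / 4 : ℝ)) ^ 4 = 10 ^ 8 * x ^ 3 := by
    rw [mul_pow, ← Real.rpow_natCast (x ^ (3 / 4 : ℝ)), ← Real.rpow_mul hx0,
      ← Real.rpow_natCast x 3]
    norm_num
  exact le_of_pow_le_pow_left₀ (by norm_num) (by positivity) (h3.trans h4.ge)

end

theorem theorem4 :
    ∃ C : ℝ, 0 < C ∧ ∀ x : ℝ, 2 ≤ x →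
      (({ℓ : ℕ | ℓ.Prime ∧ ℓ ≡ 1 [MOD 3] ∧ (ℓ : ℝ) ≤ x ∧ Demjanenko.K ℓ = ∅}.ncard : ℕ) : ℝ)
        ≤ C * x ^ (3 / 4 : ℝ) * (Real.log x) ^ 3 := by
  refine ⟨2000, by norm_num, fun x hx => ?_⟩
  -- An exceptional prime is `2 ^ s * m + 1` with `s ≤ log₂ x` and `m ≤ Y`.
  have hx0 : 0 < x := by linarith
  set Y : ℝ := 100 * x ^ (3 / 4 : ℝ)
  have hY1 : 1 ≤ x ^ (3 / 4 : ℝ) := Real.one_le_rpow (by linarith) (by norm_num)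
  set S := Nat.log 2 ⌊x⌋₊
  set B := Finset.range (S + 1) ×ˢ Finset.range (⌊Y⌋₊ + 1) with hB
  have hsub : {ℓ : ℕ | ℓ.Prime ∧ ℓ ≡ 1 [MOD 3] ∧ (ℓ : ℝ) ≤ x ∧ Demjanenko.K ℓ = ∅} ⊆
      B.image fun sm => 2 ^ sm.1 * sm.2 + 1 := by
    rintro p ⟨hp, h3, hpx, hK⟩
    have : Fact p.Prime := ⟨hp⟩
    have hp1 : p - 1 ≠ 0 := by have := hp.two_le; omega
    obtain ⟨s, m, hm, hsm⟩ := Nat.exists_eq_two_pow_mul_odd hp1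
    have hpsm : p = 2 ^ s * m + 1 := by have := hp.two_le; omega
    have hs : s ≠ 0 := by
      rintro rfl
      have h2 : p ≠ 2 := by rintro rfl; exact absurd h3 (by decide)
      have hodd := hp.odd_of_ne_two h2
      rw [pow_zero, one_mul] at hpsm
      rw [hpsm] at hodd
      exact (Nat.not_even_iff_odd.mpr hodd) (hm.add_one)
    have hlt : 2 ^ s * m + 1 < 10 ^ 8 * (2 ^ s) ^ 4 := by
      by_contra hge
      have := Demjanenko.K_nonempty hs hpsm hm h3 (by rw [hpsm]; exact not_lt.mp hge)
      exact this.ne_empty hK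
    have hmY : (m : ℝ) ≤ Y := two_adic_bound (hpsm ▸ hpx) hlt
    rw [Finset.coe_image]
    refine ⟨(s, m), ?_, hpsm.symm⟩
    rw [Finset.mem_coe, hB, Finset.mem_product, Finset.mem_range, Finset.mem_range,
      Nat.lt_succ_iff, Nat.lt_succ_iff]
    refine ⟨Nat.le_log_of_pow_le (by norm_num) ?_, Nat.le_floor hmY⟩
    have hpf : p ≤ ⌊x⌋₊ := Nat.le_floor hpx
    have : 2 ^ s ≤ 2 ^ s * m := Nat.le_mul_of_pos_right _ hm.pos
    rw [hpsm] at hpf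
    exact (this.trans (Nat.le_succ _)).trans hpf
  have hcard := (Set.ncard_le_ncard hsub (Finset.finite_toSet _))
  rw [Set.ncard_coe_finset] at hcard
  replace hcard := hcard.trans Finset.card_image_le
  rw [hB, Finset.card_product, Finset.card_range, Finset.card_range] at hcard
  have hcard' : (({ℓ : ℕ | ℓ.Prime ∧ ℓ ≡ 1 [MOD 3] ∧ (ℓ : ℝ) ≤ x ∧
      Demjanenko.K ℓ = ∅}.ncard : ℕ) : ℝ) ≤ (S + 1) * (⌊Y⌋₊ + 1) := by exact_mod_cast hcard
  refine hcard'.trans ?_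
  have hl2 := Real.log_two_gt_d9
  have hL : Real.log 2 ≤ Real.log x := Real.log_le_log (by norm_num) hx
  set L := Real.log x
  have hSL : (S : ℝ) * Real.log 2 ≤ L := by
    rw [← Real.log_pow]
    refine Real.log_le_log (by positivity) ?_
    have h1 : 2 ^ S ≤ ⌊x⌋₊ := Nat.pow_log_le_self 2 (Nat.floor_pos.mpr (by linarith)).ne'
    calc ((2 : ℝ) ^ S) = ((2 ^ S : ℕ) : ℝ) := by push_cast; rfl
      _ ≤ (⌊x⌋₊ : ℝ) := by exact_mod_cast h1
      _ ≤ x := Nat.floor_le hx0.le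
  have hS0 : (0 : ℝ) ≤ S := Nat.cast_nonneg _
  have hS1 : (S : ℝ) + 1 ≤ 4 * L := by nlinarith
  have hY2 : (⌊Y⌋₊ : ℝ) + 1 ≤ 101 * x ^ (3 / 4 : ℝ) := by
    have := Nat.floor_le (show 0 ≤ Y by positivity)
    linarith
  have hL3 : 4 * L ≤ 12 * L ^ 3 := by
    have : (1 : ℝ) ≤ 3 * L ^ 2 := by nlinarith
    nlinarith
  calc ((S : ℝ) + 1) * (⌊Y⌋₊ + 1) ≤ (12 * L ^ 3) * (101 * x ^ (3 / 4 : ℝ)) := by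
        have := hS1.trans hL3
        gcongr
        linarith
    _ = 1212 * x ^ (3 / 4 : ℝ) * L ^ 3 := by ring
    _ ≤ 2000 * x ^ (3 / 4 : ℝ) * L ^ 3 := by
        have : 0 ≤ L := by linarith
        gcongr
        norm_num
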